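/- Let $\{B_v\}_{v\in V}$ be an infinite family of pairwise disjoint open disks of radius $\tfrac12$ in the Euclidean plane $\mathbb R^2$, and let $c_v$ denote the center of $B_v$. Let $(V,E)$ be the contact graph of the family, in which $v,w\in V$ are joined by an edge if and only if the circles $\partial B_v$ and $\partial B_w$ are tangent, that is, $|c_v-c_w|=1$. Assume that $(V,E)$ is connected. Draw each vertex $v$ as the point $c_v$ and each edge $\{v,w\}$ as the straight segment $\overline{c_vc_w}$. Let $F$ be the set of faces, i.e. of connected components of the complement in $\mathbb R^2$ of the resulting drawing, and for $\sigma\in F$ let the facial degree $\deg(\sigma)\in\mathbb N\cup\{\infty\}$ be the number of corners of $\sigma$, i.e. of pairs consisting of a vertex $v$ and an open circular sector of $B_v$, cut out by the edges at $v$, that is contained in $\sigma$ (straight angles and full angles count, and a vertex may contribute several corners). Suppose that $$\sup_{\sigma\in F}\deg(\sigma)<\infty .$$ Let $d_V$ be the combinatorial distance of $(V,E)$, and let $d_{\mathbb Z^2}$ be the combinatorial distance of the graph with vertex set $\mathbb Z^2$ in which $w,z$ are adjacent if and only if $|w-z|=1$. Then the metric spaces $(V,d_V)$ and $(\mathbb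 Z^2,d_{\mathbb Z^2})$ are quasi-isometric: there are a map $\psi:V\to\mathbb Z^2$ and constants $a\ge 1$, $C>0$ such that $$a^{-1}d_V(x_1,x_2)-C\le d_{\mathbb Z^2}(\psi(x_1),\psi(x_2))\le a\,d_V(x_1,x_2)+C\qquad\text{for all }x_1,x_2\in V,$$ and for every $y\in\mathbb Z^2$ there is an $x\in V$ with $d_{\mathbb Z^2}(y,\psi(x))<C$. -/

import Mathlib

/-- A configuration of pennies in the Euclidean plane, indexed by `V`: the penny with index `v` is
the open disk of radius `1/2` around `center v`, and pennies of different index do not overlap. -/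
structure PennyConfiguration (V : Type*) where
  center : V → EuclideanSpace ℝ (Fin 2)
  disjoint_pennies : ∀ v w : V, v ≠ w →
    Disjoint (Metric.ball (center v) (1 / 2)) (Metric.ball (center w) (1 / 2))

namespace PennyConfiguration

variable {V : Type*}

/-- The penny with index `v`, an open disk of diameter `1`. -/
def penny (P : PennyConfiguration V) (v : V) : Set (EuclideanSpace ℝ (Fin 2)) :=
  Metric.ball (P.center v) (1 / 2)

/-- The contact graph. Two circles of radius `1/2` bounding disjoint disks are tangent exactly when
their centers are at distance `1/2 + 1/2 = 1`. -/
def graph (P : PennyConfiguration V) : SimpleGraph V where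
  Adj v w := dist (P.center v) (P.center w) = 1
  symm := ⟨fun v w h => by rw [dist_comm]; exact h⟩
  loopless := ⟨fun v h => by simp at h⟩

/-- The image in the plane of the geometric realization: all the centers, together with the
straight segments that join the centers of tangent pennies. -/
def drawing (P : PennyConfiguration V) : Set (EuclideanSpace ℝ (Fin 2)) :=
  Set.range P.center ∪
    ⋃ (v : V) (w : V) (_ : P.graph.Adj v w), segment ℝ (P.center v) (P.center w)

/-- The faces: the connected components of the complement of the drawing. -/
def faces (P : PennyConfiguration V) : Set (Set (EuclideanSpace ℝ (Fin 2))) :=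
  {σ | ∃ x ∈ P.drawingᶜ, σ = connectedComponentIn P.drawingᶜ x}

/-- The corners (interior angles) of a face `σ`, each given by its vertex `v` and its circular
sector at `v`. Inside the penny of `v` the drawing consists only of `center v` and of the radii
towards the neighbours of `v`, so the connected components of `σ ∩ penny v` are the open sectors
between cyclically consecutive edges at `v` that belong to `σ`. Straight angles, reflex angles, and
the full angle at a vertex of degree one all count, and a face may have several corners at the
same vertex. -/
def corners (P : PennyConfiguration V) (σ : Set (EuclideanSpace ℝ (Fin 2))) :
    Set (V × Set (EuclideanSpace ℝ (Fin 2))) :=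
  {c | ∃ x ∈ σ ∩ P.penny c.1, c.2 = connectedComponentIn (σ ∩ P.penny c.1) x}

/-- The facial degree of a face: its number of corners, possibly infinite. -/
noncomputable def facialDegree (P : PennyConfiguration V)
    (σ : Set (EuclideanSpace ℝ (Fin 2))) : ℕ∞ :=
  (P.corners σ).encard

end PennyConfiguration

/-- The integer lattice graph: `w` and `z` are adjacent when their Euclidean distance is `1`. -/
def latticeGraph : SimpleGraph (ℤ × ℤ) where
  Adj w z := (w.1 - z.1) ^ 2 + (w.2 - z.2) ^ 2 = 1
  symm := ⟨fun w z h => by rw [← h]; ring⟩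
  loopless := ⟨fun w h => by simp at h⟩

/-- The combinatorial distance of a (connected) graph, as a real number. -/
noncomputable def graphDist {V : Type*} (G : SimpleGraph V) (x y : V) : ℝ := (G.dist x y : ℝ)

/-- Quasi-isometry of the spaces `X` and `Y` with the distance functions `dX` and `dY`. -/
def QuasiIsometric {X Y : Type*} (dX : X → X → ℝ) (dY : Y → Y → ℝ) : Prop :=
  ∃ (ψ : X → Y) (a C : ℝ), 1 ≤ a ∧ 0 < C ∧
    (∀ x₁ x₂ : X, a⁻¹ * dX x₁ x₂ - C ≤ dY (ψ x₁) (ψ x₂) ∧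
      dY (ψ x₁) (ψ x₂) ≤ a * dX x₁ x₂ + C) ∧
    (∀ y : Y, ∃ x : X, dY y (ψ x) < C)

/-! The quasi-isometry sends `v` to the lattice point below and to the left of its center. Lattice
and Euclidean distances are comparable, and an edge has Euclidean length one, so the content is a
linear upper bound for graph distance by Euclidean distance, together with coarse density of the
centers.

Both come from the faces, whose degrees are bounded by some `D`. As the drawing is connected, the
complement of a face is connected, and unicoherence of the plane makes the boundary of the face
connected (`isPreconnected_frontier_face`). The closed pennies at the corners of the face cover this
boundary, and pennies that share a point are equal or tangent. Hence the corner vertices span a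
connected subgraph with at most `D` vertices, and any two are at graph distance at most `D`
(`dist_le_of_mem_cornerVertices`). As there are infinitely many pennies, the face itself stays
within `D + 1` of each of its corners (`dist_center_le_of_mem_face`).

So every point of the plane has a nearby vertex, chosen so that the choice moves a bounded graph
distance under small displacements (`exists_near_vertex_map`). Packing makes this uniform at unit
scale, and subdividing segments gives a coarse Lipschitz bound (`exists_graph_dist_le_mul`). -/

open Set Filter Topology Metric

/-! ### Plane topology: unicoherence and complements of balls. -/

/-- The plane, and more generally any simply connected, locally path connected normal space, is
unicoherent: two connected closed sets that cover it have a connected intersection. -/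
theorem IsPreconnected.inter_of_union_eq_univ {X : Type*} [TopologicalSpace X]
    [SimplyConnectedSpace X] [LocallyPathConnectedSpace X] [NormalSpace X] {s t : Set X}
    (hs : IsPreconnected s) (ht : IsPreconnected t) (hsc : IsClosed s) (htc : IsClosed t)
    (hst : s ∪ t = univ) : IsPreconnected (s ∩ t) := by
  classical
  rw [isPreconnected_closed_iff]
  rintro A B hA hB hAB ⟨a, has, haA⟩ ⟨b, hbs, hbB⟩
  by_contra hne
  have hdisj : Disjoint (s ∩ t ∩ A) (s ∩ t ∩ B) := by
    rw [Set.disjoint_left]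
    rintro x ⟨hx, hxA⟩ ⟨-, hxB⟩
    exact hne ⟨x, hx, hxA, hxB⟩
  obtain ⟨f, hf0, hf1, -⟩ := exists_continuous_zero_one_of_isClosed
    ((hsc.inter htc).inter hA) ((hsc.inter htc).inter hB) hdisj
  have hexp : Circle.exp Real.pi = Circle.exp (-Real.pi) := by
    -- Both sides are `-1`, so the two branches below agree wherever `f` is `0` or `1`, in
    -- particular on `s ∩ t`.
    ext; simp
  have hgc : Continuous fun x => if x ∈ s then Circle.exp (Real.pi * f x)
      else Circle.exp (-(Real.pi * f x)) := by
    refine Continuous.if ?_ (by fun_prop) (by fun_prop)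
    intro x hx
    have hxs : x ∈ s := hsc.frontier_subset hx
    have hxt : x ∈ t := by
      have h1 : x ∈ closure sᶜ := by
        have := hx
        rw [← frontier_compl] at this
        exact frontier_subset_closure this
      exact closure_minimal (fun y hy => (hst.symm ▸ mem_univ y : y ∈ s ∪ t).resolve_left hy) htc h1
    rcases hAB ⟨hxs, hxt⟩ with h | h
    · have := hf0 ⟨⟨hxs, hxt⟩, h⟩
      simp [this]
    · have := hf1 ⟨⟨hxs, hxt⟩, h⟩
      simpa only [this, Pi.one_apply, mul_one] using hexp
  have ha0 : f a = 0 := hf0 ⟨has, haA⟩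
  have hb1 : f b = 1 := hf1 ⟨hbs, hbB⟩
  -- Lift to the line. By connectedness of `s` and of `t`, the lift starting at `0` over `a` is `π
  -- f` on `s` and `-π f` on `t`; at `b` this reads `π = -π`.
  obtain ⟨h, ⟨ha, hh⟩, -⟩ := Circle.isCoveringMap_exp.existsUnique_continuousMap_lifts
    ⟨_, hgc⟩ a 0 (by simp [ha0])
  have hh' : ∀ x, Circle.exp (h x) = if x ∈ s then Circle.exp (Real.pi * f x)
      else Circle.exp (-(Real.pi * f x)) := fun x => congrFun hh x
  have e1 : EqOn h (fun x => Real.pi * f x) s := by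
    refine Circle.isCoveringMap_exp.eqOn_of_comp_eqOn hs (by fun_prop) (by fun_prop) ?_ has.1
      (by simp [ha, ha0])
    intro x hx
    simp [hh', hx]
  have e2 : EqOn h (fun x => -(Real.pi * f x)) t := by
    refine Circle.isCoveringMap_exp.eqOn_of_comp_eqOn ht (by fun_prop) (by fun_prop) ?_ has.2
      (by simp [ha, ha0])
    intro x hx
    by_cases hxs : x ∈ s
    · rcases hAB ⟨hxs, hx⟩ with h' | h'
      · have := hf0 ⟨⟨hxs, hx⟩, h'⟩
        simp [hh', hxs, this]
      · have := hf1 ⟨⟨hxs, hx⟩, h'⟩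
        simpa only [Function.comp_apply, hh', hxs, if_true, this, Pi.one_apply, mul_one] using hexp
    · simp [hh', hxs]
  have h1 := e1 hbs.1
  have h2 := e2 hbs.2
  simp only [hb1] at h1 h2
  linarith [Real.pi_pos]

/-- In dimension at least two, the complement of a closed ball is connected. -/
theorem isPreconnected_compl_closedBall {E : Type*} [NormedAddCommGroup E] [NormedSpace ℝ E]
    (h : 1 < Module.rank ℝ E) (x : E) {r : ℝ} (hr : 0 ≤ r) :
    IsPreconnected (closedBall x r)ᶜ := by
  have key : (closedBall x r)ᶜ =
      (fun p : ℝ × E => x + p.1 • p.2) '' (Ioi r ×ˢ sphere (0 : E) 1) := by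
    ext y
    simp only [mem_compl_iff, mem_closedBall, not_le, mem_image, mem_prod, mem_Ioi,
      mem_sphere_zero_iff_norm, Prod.exists, dist_eq_norm]
    constructor
    · intro hy
      have h0 : ‖y - x‖ ≠ 0 := by linarith
      exact ⟨‖y - x‖, ‖y - x‖⁻¹ • (y - x), ⟨hy, by simp [norm_smul, h0]⟩, by simp [smul_smul, h0]⟩
    · rintro ⟨t, u, ⟨ht, hu⟩, rfl⟩
      simpa [norm_smul, hu] using lt_of_lt_of_le ht (le_abs_self t)
  rw [key]
  exact (isPreconnected_Ioi.prod (isPreconnected_sphere h 0 1)).image _ (by fun_prop)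

/-- A connected set that meets `s` and its complement meets the frontier of `s`. -/
theorem IsPreconnected.inter_frontier_nonempty {X : Type*} [TopologicalSpace X] {s t : Set X}
    (ht : IsPreconnected t) (h : (t ∩ s).Nonempty) (h' : (t ∩ sᶜ).Nonempty) :
    (t ∩ frontier s).Nonempty := by
  obtain ⟨x, hxt, hx⟩ := isPreconnected_closed_iff.1 ht (closure s) (closure sᶜ) isClosed_closure
    isClosed_closure (fun x _ => (em (x ∈ s)).imp (fun h => subset_closure h)
      fun h => subset_closure h)
    (h.mono (inter_subset_inter_right _ subset_closure))
    (h'.mono (inter_subset_inter_right _ subset_closure))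
  exact ⟨x, hxt, by rwa [frontier_eq_closure_inter_closure]⟩

/-! ### Distances in graphs. -/

/-- A bound for distances along a graph `H` on a finite set of vertices of `G`, whose edges have
bounded length in `G`. -/
theorem SimpleGraph.dist_le_of_reachable_on_finite {V : Type*} {G : SimpleGraph V}
    (hG : G.Connected) {S : Set V} {N k : ℕ} (hS : S.encard ≤ N) (H : SimpleGraph S)
    (hH : ∀ a b, H.Adj a b → G.dist a b ≤ k) {a b : S} (hab : H.Reachable a b) :
    G.dist a b ≤ k * N := by
  classical
  have hfin : S.Finite := Set.finite_of_encard_le_coe hS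
  have := hfin.fintype
  obtain ⟨p, hp⟩ := hab.exists_isPath
  have hw : ∀ {a b : S} (p : H.Walk a b), G.dist a b ≤ k * p.length := by
    intro a b p
    induction p with
    | nil => simp
    | @cons u v w h p ih =>
      have := hG.dist_triangle (u := (u : V)) (v := (v : V)) (w := (w : V))
      have h1 := hH _ _ h
      rw [SimpleGraph.Walk.length_cons, mul_add]
      omega
  -- A path repeats no vertex, so its length is less than the number of vertices.
  have hlen := hp.length_lt
  have hcard : Fintype.card S ≤ N := by
    rw [← Set.toFinset_card, ← Set.ncard_eq_toFinset_card']
    have := hS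
    rw [← hfin.cast_ncard_eq] at this
    exact_mod_cast this
  exact (hw p).trans (Nat.mul_le_mul_left _ (by omega))

/-- A map that does not increase the distance along edges does not increase it along walks. -/
theorem dist_map_le_graph_dist {V M : Type*} [PseudoMetricSpace M] {G : SimpleGraph V}
    (hG : G.Connected) {f : V → M} (hf : ∀ a b, G.Adj a b → dist (f a) (f b) ≤ 1) (a b : V) :
    dist (f a) (f b) ≤ G.dist a b := by
  obtain ⟨p, hp⟩ := hG.exists_walk_length_eq_dist a b
  rw [← hp]
  clear hp
  induction p with
  | nil => simp
  | @cons u v w h p ih =>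
    have := dist_triangle (f u) (f v) (f w)
    have h1 := hf _ _ h
    rw [SimpleGraph.Walk.length_cons]
    push_cast
    linarith

/-! ### Metric geometry of pennies and of the drawing. -/

/-- Distinct edges at a vertex make an angle of at least 60 degrees, so the inner product is at most
`1/2` and the squared norm is at least `(t - 1/4)² + 3/16`. This keeps other edges at an endpoint
away from the midpoint of a given edge. -/
theorem one_quarter_le_norm_smul_sub_half {E : Type*} [NormedAddCommGroup E]
    [InnerProductSpace ℝ E] {X Y : E} (hX : ‖X‖ = 1) (hY : ‖Y‖ = 1) (hXY : 1 ≤ ‖X - Y‖) {t : ℝ}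
    (ht : 0 ≤ t) : 1 / 4 ≤ ‖t • X - (1 / 2 : ℝ) • Y‖ := by
  have h1 := norm_sub_sq_real X Y
  have h2 := norm_sub_sq_real (t • X) ((1 / 2 : ℝ) • Y)
  rw [norm_smul, norm_smul, inner_smul_left, inner_smul_right, hX, hY] at h2
  simp only [hX, hY, Real.norm_eq_abs, conj_trivial, abs_of_nonneg ht] at h1 h2
  rw [abs_of_pos (by norm_num)] at h2
  have h3 : inner ℝ X Y ≤ 1 / 2 := by nlinarith
  have h4 : t * inner ℝ X Y ≤ t * (1 / 2) := mul_le_mul_of_nonneg_left h3 ht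
  refine le_of_sq_le_sq ?_ (norm_nonneg _)
  nlinarith [sq_nonneg (t - 1 / 4)]

/-- The parallelogram law gives `‖X + Y‖² ≥ 3`. This keeps every third center away from the midpoint
of an edge. -/
theorem three_quarters_le_norm_half_smul_add {E : Type*} [NormedAddCommGroup E]
    [InnerProductSpace ℝ E] {X Y : E} (hX : 1 ≤ ‖X‖) (hY : 1 ≤ ‖Y‖) (hXY : ‖X - Y‖ = 1) :
    3 / 4 ≤ ‖(1 / 2 : ℝ) • (X + Y)‖ := by
  have h := parallelogram_law_with_norm ℝ X Y
  rw [norm_smul, Real.norm_eq_abs, abs_of_pos (by norm_num)]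
  by_contra hlt
  have h1 : ‖X + Y‖ < 3 / 2 := by linarith
  rw [hXY] at h
  nlinarith [norm_nonneg (X + Y)]

namespace PennyConfiguration

variable {V : Type*} (P : PennyConfiguration V)

theorem one_le_dist_center {v w : V} (h : v ≠ w) : 1 ≤ dist (P.center v) (P.center w) := by
  have := (disjoint_ball_ball_iff (by norm_num) (by norm_num)).1 (P.disjoint_pennies v w h)
  linarith

theorem eq_or_adj_of_dist_le_one {v w : V} (h : dist (P.center v) (P.center w) ≤ 1) :
    v = w ∨ P.graph.Adj v w := by
  by_cases hvw : v = w
  · exact Or.inl hvw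
  · exact Or.inr (le_antisymm h (P.one_le_dist_center hvw))

theorem eq_or_adj_of_mem_closedBall {v w : V} {x : EuclideanSpace ℝ (Fin 2)}
    (hv : x ∈ closedBall (P.center v) (1 / 2)) (hw : x ∈ closedBall (P.center w) (1 / 2)) :
    v = w ∨ P.graph.Adj v w := by
  refine P.eq_or_adj_of_dist_le_one ?_
  rw [mem_closedBall] at hv hw
  linarith [dist_triangle_left (P.center v) (P.center w) x]

/-- A ball contains a bounded number of centers. -/
theorem exists_encard_center_le (ρ : ℝ) :
    ∃ N : ℕ, ∀ x, {v | dist (P.center v) x ≤ ρ}.encard ≤ N := by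
  set m : ℤ := ⌈2 * ρ⌉ + 1 with hm
  refine ⟨(Finset.Icc (-m) m ×ˢ Finset.Icc (-m) m).card, fun x => ?_⟩
  rw [← Set.encard_coe_eq_coe_finsetCard]
  -- Grid cells of side `1/2` have diameter less than `1`, so each contains at most one center.
  refine Set.encard_le_encard_of_injOn
    (f := fun v => (⌊2 * (P.center v 0 - x 0)⌋, ⌊2 * (P.center v 1 - x 1)⌋)) ?_ ?_
  · intro v hv
    have hv' : dist (P.center v) x ≤ ρ := hv
    have hcoord : ∀ i, -m ≤ ⌊2 * (P.center v i - x i)⌋ ∧ ⌊2 * (P.center v i - x i)⌋ ≤ m := by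
      intro i
      have h1 : |P.center v i - x i| ≤ ρ := by
        have := PiLp.norm_apply_le (P.center v - x) i
        rw [← dist_eq_norm] at this
        exact this.trans hv'
      have h2 := abs_le.1 h1
      have h3 := Int.le_ceil (2 * ρ)
      constructor
      · rw [Int.le_floor, hm]
        push_cast
        linarith
      · have : ((⌊2 * (P.center v i - x i)⌋ : ℤ) : ℝ) ≤ (m : ℝ) := by
          rw [hm]
          push_cast
          linarith [Int.floor_le (2 * (P.center v i - x i))]
        exact_mod_cast this
    simp only [Finset.coe_product, Finset.coe_Icc, mem_prod, mem_Icc]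
    exact ⟨hcoord 0, hcoord 1⟩
  · intro v _ w _ hvw
    by_contra hne
    have h1 := P.one_le_dist_center hne
    simp only [Prod.mk.injEq] at hvw
    have a0 := Int.abs_sub_lt_one_of_floor_eq_floor hvw.1
    have a1 := Int.abs_sub_lt_one_of_floor_eq_floor hvw.2
    rw [EuclideanSpace.dist_eq, Real.le_sqrt' one_pos] at h1
    simp only [Fin.sum_univ_two, Real.dist_eq, sq_abs] at h1
    have b0 := sq_lt_one_iff_abs_lt_one _ |>.2 a0
    have b1 := sq_lt_one_iff_abs_lt_one _ |>.2 a1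
    nlinarith

theorem finite_center_le (x : EuclideanSpace ℝ (Fin 2)) (ρ : ℝ) :
    {v | dist (P.center v) x ≤ ρ}.Finite := by
  obtain ⟨N, hN⟩ := P.exists_encard_center_le ρ
  exact Set.finite_of_encard_le_coe (hN x)

theorem locallyFinite_closedBall :
    LocallyFinite fun v => closedBall (P.center v) (1 / 2) := by
  intro x
  refine ⟨ball x 1, ball_mem_nhds x one_pos, (P.finite_center_le x 2).subset ?_⟩
  rintro v ⟨y, hy, hyx⟩
  rw [mem_closedBall] at hy
  rw [mem_ball] at hyx
  simp only [mem_ofPred_eq]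
  linarith [dist_triangle_left (P.center v) x y]

theorem isClosed_drawing : IsClosed P.drawing := by
  classical
  -- Centers enter as degenerate segments, so that the drawing is the union of one locally finite
  -- family of compact segments.
  let f : V × V → Set (EuclideanSpace ℝ (Fin 2)) := fun p =>
    if p.1 = p.2 ∨ P.graph.Adj p.1 p.2 then segment ℝ (P.center p.1) (P.center p.2) else ∅
  have hf : P.drawing = ⋃ p, f p := by
    ext x
    simp only [drawing, mem_union, mem_range, mem_iUnion, f, Prod.exists]
    constructor
    · rintro (⟨v, rfl⟩ | ⟨v, w, h, hx⟩)
      · exact ⟨v, v, by simp⟩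
      · exact ⟨v, w, by simpa [h] using hx⟩
    · rintro ⟨v, w, hx⟩
      split_ifs at hx with h
      · rcases h with rfl | h
        · left
          exact ⟨v, by simpa [eq_comm] using hx⟩
        · exact Or.inr ⟨v, w, h, hx⟩
      · exact hx.elim
  rw [hf]
  refine LocallyFinite.isClosed_iUnion ?_ ?_
  · intro x
    refine ⟨ball x 1, ball_mem_nhds x one_pos,
      ((P.finite_center_le x 2).prod (P.finite_center_le x 2)).subset ?_⟩
    rintro ⟨v, w⟩ ⟨y, hy, hyx⟩
    simp only [f] at hy
    split_ifs at hy with h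
    · have hvw : dist (P.center v) (P.center w) ≤ 1 := by
        rcases h with rfl | h
        · simp
        · exact le_of_eq h
      rw [mem_ball] at hyx
      have h1 := dist_add_dist_of_mem_segment hy
      have h2 := dist_triangle (P.center v) y x
      have h3 := dist_triangle_left (P.center w) x y
      have h4 := dist_nonneg (x := P.center v) (y := y)
      have h5 := dist_nonneg (x := y) (y := P.center w)
      simp only [mem_prod, mem_ofPred_eq]
      constructor <;> linarith
    · exact hy.elim
  · rintro ⟨v, w⟩
    simp only [f]
    split_ifs
    · rw [segment_eq_image]
      exact (isCompact_Icc.image (by fun_prop)).isClosed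
    · exact isClosed_empty

theorem center_mem_drawing (v : V) : P.center v ∈ P.drawing := Or.inl ⟨v, rfl⟩

theorem segment_subset_drawing {v w : V} (h : P.graph.Adj v w) :
    segment ℝ (P.center v) (P.center w) ⊆ P.drawing := fun _ hx =>
  Or.inr (mem_iUnion₂.2 ⟨v, w, mem_iUnion.2 ⟨h, hx⟩⟩)

/-- Every point of the drawing lies on a half-edge. -/
theorem exists_half_edge_of_mem_drawing [Nontrivial V] (hconn : P.graph.Connected)
    {x : EuclideanSpace ℝ (Fin 2)} (hx : x ∈ P.drawing) :
    ∃ a b, P.graph.Adj a b ∧ ∃ t : ℝ, 0 ≤ t ∧ t ≤ 1 / 2 ∧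
      x = P.center a + t • (P.center b - P.center a) := by
  rcases hx with ⟨v, rfl⟩ | hx
  · obtain ⟨w, hw⟩ := hconn.preconnected.exists_adj_of_nontrivial v
    exact ⟨v, w, hw, 0, le_rfl, by norm_num, by simp⟩
  · simp only [mem_iUnion] at hx
    obtain ⟨v, w, h, hx⟩ := hx
    rw [segment_eq_image'] at hx
    obtain ⟨t, ht, rfl⟩ := hx
    rcases le_total t (1 / 2) with h2 | h2
    · exact ⟨v, w, h, t, ht.1, h2, rfl⟩
    · refine ⟨w, v, h.symm, 1 - t, by linarith [ht.2], by linarith, ?_⟩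
      module

/-- Near the midpoint of an edge, the drawing lies on the line through that edge. -/
theorem mem_line_of_dist_midpoint_lt [Nontrivial V] (hconn : P.graph.Connected) {a b : V}
    (hab : P.graph.Adj a b) {p : EuclideanSpace ℝ (Fin 2)} (hp : p ∈ P.drawing)
    (hpm : dist p (P.center a + (1 / 2 : ℝ) • (P.center b - P.center a)) < 1 / 4) :
    ∃ s : ℝ, p = P.center a + s • (P.center b - P.center a) := by
  obtain ⟨u, w, huw, t, ht0, ht2, rfl⟩ := P.exists_half_edge_of_mem_drawing hconn hp
  have key : ∀ {a b : V}, P.graph.Adj a b → P.graph.Adj a w →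
      dist (P.center a + t • (P.center w - P.center a))
        (P.center a + (1 / 2 : ℝ) • (P.center b - P.center a)) < 1 / 4 → w = b := by
    intro a b hab haw hlt
    by_contra hwb
    refine absurd hlt (not_lt.2 ?_)
    rw [dist_add_left, dist_eq_norm]
    refine one_quarter_le_norm_smul_sub_half ?_ ?_ ?_ ht0
    · rw [← dist_eq_norm]; exact haw.symm
    · rw [← dist_eq_norm]; exact hab.symm
    · rw [sub_sub_sub_cancel_right, ← dist_eq_norm]; exact P.one_le_dist_center hwb
  by_cases hua : u = a
  · subst hua
    obtain rfl := key hab huw hpm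
    exact ⟨t, rfl⟩
  by_cases hub : u = b
  · subst hub
    have hmid : P.center a + (1 / 2 : ℝ) • (P.center u - P.center a) =
      P.center u + (1 / 2 : ℝ) • (P.center a - P.center u) := by module
    rw [hmid] at hpm
    obtain rfl := key hab.symm huw hpm
    exact ⟨1 - t, by module⟩
  -- The half-edge starts at a third vertex, at least `3/4` from the midpoint, and has length at
  -- most `1/2`, so it cannot come closer than `1/4`.
  exfalso
  have h1 : 3 / 4 ≤ ‖(1 / 2 : ℝ) • ((P.center a - P.center u) + (P.center b - P.center u))‖ := by
    refine three_quarters_le_norm_half_smul_add ?_ ?_ ?_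
    · rw [← dist_eq_norm]; exact P.one_le_dist_center (Ne.symm hua)
    · rw [← dist_eq_norm]; exact P.one_le_dist_center (Ne.symm hub)
    · rw [sub_sub_sub_cancel_right, ← dist_eq_norm]; exact hab
  have h2 : ‖t • (P.center w - P.center u)‖ ≤ 1 / 2 := by
    rw [norm_smul, ← dist_eq_norm, dist_comm, huw, Real.norm_eq_abs, abs_of_nonneg ht0]
    linarith
  have h3 : (1 / 2 : ℝ) • ((P.center a - P.center u) + (P.center b - P.center u)) =
      t • (P.center w - P.center u) - (P.center u + t • (P.center w - P.center u) -
        (P.center a + (1 / 2 : ℝ) • (P.center b - P.center a))) := by module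
  rw [h3] at h1
  rw [dist_eq_norm] at hpm
  linarith [norm_sub_le (t • (P.center w - P.center u)) (P.center u + t • (P.center w - P.center u) -
        (P.center a + (1 / 2 : ℝ) • (P.center b - P.center a)))]

/-! ### Faces -/

variable {P}

theorem isOpen_of_mem_faces {σ : Set (EuclideanSpace ℝ (Fin 2))} (hσ : σ ∈ P.faces) :
    IsOpen σ := by
  obtain ⟨x, hx, rfl⟩ := hσ
  exact P.isClosed_drawing.isOpen_compl.connectedComponentIn

theorem isPreconnected_of_mem_faces {σ : Set (EuclideanSpace ℝ (Fin 2))} (hσ : σ ∈ P.faces) :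
    IsPreconnected σ := by
  obtain ⟨x, hx, rfl⟩ := hσ
  exact isPreconnected_connectedComponentIn

theorem nonempty_of_mem_faces {σ : Set (EuclideanSpace ℝ (Fin 2))} (hσ : σ ∈ P.faces) :
    σ.Nonempty := by
  obtain ⟨x, hx, rfl⟩ := hσ
  exact ⟨x, mem_connectedComponentIn hx⟩

theorem subset_compl_drawing_of_mem_faces {σ : Set (EuclideanSpace ℝ (Fin 2))}
    (hσ : σ ∈ P.faces) : σ ⊆ P.drawingᶜ := by
  obtain ⟨x, hx, rfl⟩ := hσ
  exact connectedComponentIn_subset _ _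

theorem subset_face_of_isPreconnected {σ K : Set (EuclideanSpace ℝ (Fin 2))} (hσ : σ ∈ P.faces)
    (hK : IsPreconnected K) (hKd : K ⊆ P.drawingᶜ) (h : (K ∩ σ).Nonempty) : K ⊆ σ := by
  obtain ⟨y, hyK, hyσ⟩ := h
  obtain ⟨x, hx, rfl⟩ := hσ
  rw [connectedComponentIn_eq hyσ]
  exact hK.subset_connectedComponentIn hyK hKd

theorem exists_face_of_notMem_drawing {x : EuclideanSpace ℝ (Fin 2)} (hx : x ∉ P.drawing) :
    ∃ σ ∈ P.faces, x ∈ σ :=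
  ⟨_, ⟨x, hx, rfl⟩, mem_connectedComponentIn hx⟩

theorem frontier_face_subset_drawing {σ : Set (EuclideanSpace ℝ (Fin 2))} (hσ : σ ∈ P.faces) :
    frontier σ ⊆ P.drawing := by
  intro x hx
  by_contra hxd
  obtain ⟨τ, hτ, hxτ⟩ := exists_face_of_notMem_drawing hxd
  have hmeet : (τ ∩ σ).Nonempty :=
    mem_closure_iff.1 (frontier_subset_closure hx) τ (isOpen_of_mem_faces hτ) hxτ
  have hsub := subset_face_of_isPreconnected hσ (isPreconnected_of_mem_faces hτ)
    (subset_compl_drawing_of_mem_faces hτ) hmeet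
  rw [(isOpen_of_mem_faces hσ).frontier_eq] at hx
  exact hx.2 (hsub hxτ)

variable (P)

/-- The vertices at which a set has a corner. -/
def cornerVertices (σ : Set (EuclideanSpace ℝ (Fin 2))) : Set V :=
  {v | (σ ∩ P.penny v).Nonempty}

theorem encard_cornerVertices_le (σ : Set (EuclideanSpace ℝ (Fin 2))) :
    (P.cornerVertices σ).encard ≤ P.facialDegree σ := by
  refine le_trans (Set.encard_le_encard ?_) (Set.encard_image_le Prod.fst (P.corners σ))
  rintro v ⟨x, hx⟩
  exact ⟨(v, connectedComponentIn (σ ∩ P.penny v) x), ⟨x, hx, rfl⟩, rfl⟩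

/-- At every point `x` of the drawing there is a penny whose closure contains `x` such that all
faces near `x` have a corner at its center. -/
theorem exists_vertex_near_drawing [Nontrivial V] (hconn : P.graph.Connected)
    {x : EuclideanSpace ℝ (Fin 2)} (hx : x ∈ P.drawing) :
    ∃ a, x ∈ closedBall (P.center a) (1 / 2) ∧
      ∀ᶠ y in 𝓝 x, ∀ σ ∈ P.faces, y ∈ σ → a ∈ P.cornerVertices σ := by
  obtain ⟨a, b, hab, t, ht0, ht2, rfl⟩ := P.exists_half_edge_of_mem_drawing hconn hx
  have hnorm : ‖P.center b - P.center a‖ = 1 := by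
    rw [← dist_eq_norm]; exact hab.symm
  have hdist : dist (P.center a + t • (P.center b - P.center a)) (P.center a) = t := by
    rw [dist_eq_norm, add_sub_cancel_left, norm_smul, hnorm, mul_one, Real.norm_eq_abs,
      abs_of_nonneg ht0]
  refine ⟨a, by rw [mem_closedBall, hdist]; exact ht2, ?_⟩
  -- For `t < 1/2` the point lies in the open penny of `a`, and so do all points near it. The
  -- delicate case is the tangency point `t = 1/2`.
  rcases ht2.lt_or_eq with ht2 | rfl
  · filter_upwards [isOpen_ball.mem_nhds (mem_ball.2 (hdist.trans_lt ht2))] with y hy σ _ hyσ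
    exact ⟨y, hyσ, hy⟩
  set d := P.center b - P.center a with hd
  filter_upwards [ball_mem_nhds _ (show (0 : ℝ) < 1 / 16 by norm_num)] with y hy σ hσ hyσ
  rw [mem_ball, dist_eq_norm] at hy
  have hstep : ∀ s ∈ Icc (0 : ℝ) (1 / 8), ‖s • d‖ ≤ 1 / 8 := by
    intro s hs
    rw [norm_smul, hnorm, mul_one, Real.norm_eq_abs, abs_of_nonneg hs.1]
    exact hs.2
  -- Slide `y` parallel to the edge towards `a`. The path stays within `1/16 + 1/8 < 1/4` of the
  -- midpoint, where the drawing lies on the line of the edge; meeting it would put `y` itself on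
  -- the edge. The path ends within `1/16 + 3/8 < 1/2` of the center of `a`.
  have hpath : (fun s : ℝ => y - s • d) '' Icc 0 (1 / 8) ⊆ σ := by
    refine subset_face_of_isPreconnected hσ (isPreconnected_Icc.image _ (by fun_prop)) ?_
      ⟨y, ⟨0, by norm_num, by simp⟩, hyσ⟩
    rintro _ ⟨s, hs, rfl⟩ hmem
    obtain ⟨r, hr⟩ := P.mem_line_of_dist_midpoint_lt hconn hab hmem (by
      rw [dist_eq_norm, ← hd]
      have h1 : y - s • d - (P.center a + (1 / 2 : ℝ) • d) =
        (y - (P.center a + (1 / 2 : ℝ) • d)) - s • d := by module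
      rw [h1]
      linarith [norm_sub_le (y - (P.center a + (1 / 2 : ℝ) • d)) (s • d), hstep s hs])
    have hy' : y = P.center a + (r + s) • d := by
      rw [add_smul, ← add_assoc, hd, ← hr, ← hd]
      simp
    have hrs : |r + s - 1 / 2| < 1 / 16 := by
      have h1 : y - (P.center a + (1 / 2 : ℝ) • d) = (r + s - 1 / 2) • d := by
        rw [hy']; module
      rwa [h1, norm_smul, hnorm, mul_one, Real.norm_eq_abs] at hy
    rw [abs_lt] at hrs
    refine subset_compl_drawing_of_mem_faces hσ hyσ (P.segment_subset_drawing hab ?_)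
    rw [segment_eq_image']
    exact ⟨r + s, ⟨by linarith, by linarith⟩, hy'.symm⟩
  refine ⟨y - (1 / 8 : ℝ) • d, hpath ⟨1 / 8, by norm_num, rfl⟩, ?_⟩
  rw [penny, mem_ball, dist_eq_norm]
  have h1 : y - (1 / 8 : ℝ) • d - P.center a =
      (y - (P.center a + (1 / 2 : ℝ) • d)) + (3 / 8 : ℝ) • d := by module
  rw [h1]
  have h2 : ‖(3 / 8 : ℝ) • d‖ = 3 / 8 := by
    rw [norm_smul, hnorm]; norm_num
  linarith [norm_add_le (y - (P.center a + (1 / 2 : ℝ) • d)) ((3 / 8 : ℝ) • d)]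

end PennyConfiguration

/-! ### Connectedness of face boundaries, and the corners along them. -/

namespace PennyConfiguration

variable {V : Type*} (P : PennyConfiguration V)

theorem isPreconnected_drawing (hconn : P.graph.Connected) : IsPreconnected P.drawing := by
  obtain ⟨v₀⟩ := hconn.nonempty
  have hwalk : ∀ {v w : V}, P.graph.Walk v w → JoinedIn P.drawing (P.center v) (P.center w) := by
    intro v w p
    induction p with
    | nil => exact JoinedIn.refl (P.center_mem_drawing _)
    | cons h p ih => exact (JoinedIn.of_segment_subset (P.segment_subset_drawing h)).trans ih
  have hpc : IsPathConnected P.drawing := by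
    refine ⟨P.center v₀, P.center_mem_drawing v₀, ?_⟩
    rintro x (⟨v, rfl⟩ | hx)
    · obtain ⟨p⟩ := hconn.preconnected v₀ v
      exact hwalk p
    · simp only [mem_iUnion] at hx
      obtain ⟨v, w, h, hx⟩ := hx
      obtain ⟨p⟩ := hconn.preconnected v₀ v
      refine (hwalk p).trans (JoinedIn.of_segment_subset ?_)
      exact ((convex_segment _ _).segment_subset (left_mem_segment _ _ _) hx).trans
        (P.segment_subset_drawing h)
  exact hpc.isConnected.isPreconnected

variable {P}

theorem frontier_face_nonempty [Nonempty V] {σ : Set (EuclideanSpace ℝ (Fin 2))}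
    (hσ : σ ∈ P.faces) : (frontier σ).Nonempty := by
  obtain ⟨v⟩ := ‹Nonempty V›
  refine nonempty_frontier_iff.2 ⟨nonempty_of_mem_faces hσ, ?_⟩
  rintro rfl
  exact subset_compl_drawing_of_mem_faces hσ (mem_univ _) (P.center_mem_drawing v)

/-- The complement is the connected drawing with the closures of the other faces attached, each
touching the drawing along its nonempty frontier. -/
theorem isPreconnected_compl_face (hconn : P.graph.Connected)
    {σ : Set (EuclideanSpace ℝ (Fin 2))} (hσ : σ ∈ P.faces) : IsPreconnected σᶜ := by
  have := hconn.nonempty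
  obtain ⟨v₀⟩ := hconn.nonempty
  have hd : P.drawing ⊆ σᶜ := fun x hx hxσ => subset_compl_drawing_of_mem_faces hσ hxσ hx
  refine isPreconnected_of_forall (P.center v₀) fun y hy => ?_
  by_cases hyd : y ∈ P.drawing
  · exact ⟨P.drawing, hd, P.center_mem_drawing v₀, hyd, P.isPreconnected_drawing hconn⟩
  obtain ⟨τ, hτ, hyτ⟩ := exists_face_of_notMem_drawing hyd
  refine ⟨P.drawing ∪ closure τ, union_subset hd ?_, Or.inl (P.center_mem_drawing v₀),
    Or.inr (subset_closure hyτ), ?_⟩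
  · intro z hz hzσ
    obtain ⟨w, hwσ, hwτ⟩ := mem_closure_iff.1 hz σ (isOpen_of_mem_faces hσ) hzσ
    exact hy (subset_face_of_isPreconnected hσ (isPreconnected_of_mem_faces hτ)
      (subset_compl_drawing_of_mem_faces hτ) ⟨w, hwτ, hwσ⟩ hyτ)
  · obtain ⟨z, hz⟩ := frontier_face_nonempty hτ
    exact (P.isPreconnected_drawing hconn).union z (frontier_face_subset_drawing hτ hz)
      (frontier_subset_closure hz) (isPreconnected_of_mem_faces hτ).closure

/-- The boundary of a face of a connected configuration is connected. -/
theorem isPreconnected_frontier_face (hconn : P.graph.Connected)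
    {σ : Set (EuclideanSpace ℝ (Fin 2))} (hσ : σ ∈ P.faces) : IsPreconnected (frontier σ) := by
  have hopen := isOpen_of_mem_faces hσ
  rw [hopen.frontier_eq, sdiff_eq]
  -- The frontier is the intersection of `closure σ` and `σᶜ`, two connected closed sets that cover
  -- the plane.
  refine (isPreconnected_of_mem_faces hσ).closure.inter_of_union_eq_univ
    (isPreconnected_compl_face hconn hσ) isClosed_closure hopen.isClosed_compl ?_
  exact eq_univ_of_forall fun x => (em (x ∈ σ)).imp (fun h => subset_closure h) id

theorem exists_cornerVertex_of_mem_frontier [Nontrivial V] (hconn : P.graph.Connected)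
    {σ : Set (EuclideanSpace ℝ (Fin 2))} (hσ : σ ∈ P.faces) {x : EuclideanSpace ℝ (Fin 2)}
    (hx : x ∈ frontier σ) : ∃ a ∈ P.cornerVertices σ, x ∈ closedBall (P.center a) (1 / 2) := by
  obtain ⟨a, hxa, hnear⟩ := P.exists_vertex_near_drawing hconn (frontier_face_subset_drawing hσ hx)
  obtain ⟨y, hyσ, hy⟩ := (mem_closure_iff_frequently.1 (frontier_subset_closure hx)
    |>.and_eventually hnear).exists
  exact ⟨a, hy σ hσ hyσ, hxa⟩

theorem cornerVertices_nonempty [Nontrivial V] (hconn : P.graph.Connected)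
    {σ : Set (EuclideanSpace ℝ (Fin 2))} (hσ : σ ∈ P.faces) : (P.cornerVertices σ).Nonempty := by
  obtain ⟨x, hx⟩ := frontier_face_nonempty hσ
  obtain ⟨a, ha, -⟩ := exists_cornerVertex_of_mem_frontier hconn hσ hx
  exact ⟨a, ha⟩

-- By local finiteness, the closed pennies missing `x` also miss a neighborhood of `x`. This is the
-- local step when vertices are chained along a connected set.
variable (P) in
theorem eventually_mem_closedBall_imp (x : EuclideanSpace ℝ (Fin 2)) :
    ∀ᶠ y in 𝓝 x, ∀ v, y ∈ closedBall (P.center v) (1 / 2) →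
      x ∈ closedBall (P.center v) (1 / 2) := by
  filter_upwards [P.locallyFinite_closedBall.iInter_compl_mem_nhds
    (fun v => isClosed_closedBall) x] with y hy v hyv
  by_contra hxv
  exact mem_iInter₂.1 hy v hxv hyv

/-- The corners of a face are close to each other in the contact graph. -/
theorem dist_le_of_mem_cornerVertices [Nontrivial V] (hconn : P.graph.Connected)
    {σ : Set (EuclideanSpace ℝ (Fin 2))} (hσ : σ ∈ P.faces) {D : ℕ} (hD : P.facialDegree σ ≤ D)
    {v w : V} (hv : v ∈ P.cornerVertices σ) (hw : w ∈ P.cornerVertices σ) :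
    P.graph.dist v w ≤ D := by
  let H := P.graph.induce (P.cornerVertices σ)
  have hadj : ∀ {u u' : P.cornerVertices σ} {x : EuclideanSpace ℝ (Fin 2)},
      x ∈ closedBall (P.center u) (1 / 2) → x ∈ closedBall (P.center u') (1 / 2) →
      H.Reachable u u' := by
    intro u u' x hu hu'
    rcases P.eq_or_adj_of_mem_closedBall hu hu' with h | h
    · rw [Subtype.ext h]
    · exact SimpleGraph.Adj.reachable (G := H) h
  -- Chaining along the connected frontier: nearby points lie in pennies with a common point, and
  -- every intermediate point lies in the closed penny of some corner vertex.
  have hR : ∀ {x y : EuclideanSpace ℝ (Fin 2)}, x ∈ frontier σ → y ∈ frontier σ →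
      ∀ u u' : P.cornerVertices σ, x ∈ closedBall (P.center u) (1 / 2) →
      y ∈ closedBall (P.center u') (1 / 2) → H.Reachable u u' := by
    intro x y hx hy
    refine (isPreconnected_frontier_face hconn hσ).induction₂
      (fun x y => ∀ u u' : P.cornerVertices σ, x ∈ closedBall (P.center u) (1 / 2) →
        y ∈ closedBall (P.center u') (1 / 2) → H.Reachable u u') ?_ ?_ ?_ hx hy
    · intro x _
      filter_upwards [nhdsWithin_le_nhds (P.eventually_mem_closedBall_imp x)] with y hy u u' hu hu'
      exact hadj hu (hy _ hu')
    · intro x y z _ hy _ hxy hyz u u' hu hu'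
      obtain ⟨a, ha, hya⟩ := exists_cornerVertex_of_mem_frontier hconn hσ hy
      exact (hxy u ⟨a, ha⟩ hu hya).trans (hyz ⟨a, ha⟩ u' hya hu')
    · intro x y _ _ hxy u u' hu hu'
      exact (hxy u' u hu' hu).symm
  -- The penny contains a point of `σ`, while its center lies on the drawing and so outside `σ`.
  have hmeet : ∀ v ∈ P.cornerVertices σ, ∃ x ∈ frontier σ, x ∈ closedBall (P.center v) (1 / 2) := by
    rintro v ⟨y, hyσ, hyv⟩
    obtain ⟨x, hxv, hx⟩ := (convex_ball (P.center v) (1 / 2)).isPreconnected.inter_frontier_nonempty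
      ⟨y, hyv, hyσ⟩ ⟨P.center v, mem_ball_self (by norm_num), fun h =>
        subset_compl_drawing_of_mem_faces hσ h (P.center_mem_drawing v)⟩
    exact ⟨x, hx, ball_subset_closedBall hxv⟩
  obtain ⟨x, hx, hxv⟩ := hmeet v hv
  obtain ⟨y, hy, hyw⟩ := hmeet w hw
  have := SimpleGraph.dist_le_of_reachable_on_finite hconn (k := 1)
    ((P.encard_cornerVertices_le σ).trans hD) H
    (fun a b hab => ((SimpleGraph.dist_eq_one_iff_adj (G := P.graph)).2 hab).le) (hR hx hy ⟨v, hv⟩ ⟨w, hw⟩ hxv hyw)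
  simpa using this

variable (P) in
theorem dist_center_le_graph_dist (hconn : P.graph.Connected) (v w : V) :
    dist (P.center v) (P.center w) ≤ P.graph.dist v w :=
  dist_map_le_graph_dist hconn (fun _ _ h => le_of_eq h) v w

/-- A face of bounded degree stays close to its corners. -/
theorem dist_center_le_of_mem_face [Infinite V] (hconn : P.graph.Connected)
    {σ : Set (EuclideanSpace ℝ (Fin 2))} (hσ : σ ∈ P.faces) {D : ℕ} (hD : P.facialDegree σ ≤ D)
    {v : V} (hv : v ∈ P.cornerVertices σ) {x : EuclideanSpace ℝ (Fin 2)} (hx : x ∈ σ) :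
    dist x (P.center v) ≤ D + 1 := by
  by_contra hlt
  have hrank : 1 < Module.rank ℝ (EuclideanSpace ℝ (Fin 2)) := by
    rw [← Module.finrank_eq_rank, finrank_euclideanSpace_fin]
    norm_num
  -- Infinitely many pennies force a center outside the ball. The exterior of the ball is connected
  -- and meets both `σ` and its complement, so it contains a frontier point; but such a point is
  -- within `1/2` of a corner at distance at most `D` from `v`.
  obtain ⟨u, hu⟩ := (P.finite_center_le (P.center v) (D + 1)).exists_notMem
  obtain ⟨z, hz, hzf⟩ := (isPreconnected_compl_closedBall hrank (P.center v)
    (show (0 : ℝ) ≤ D + 1 by positivity)).inter_frontier_nonempty (s := σ)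
    ⟨x, hlt, hx⟩ ⟨P.center u, hu, fun h =>
        subset_compl_drawing_of_mem_faces hσ h (P.center_mem_drawing u)⟩
  obtain ⟨w, hw, hzw⟩ := exists_cornerVertex_of_mem_frontier hconn hσ hzf
  apply hz
  rw [mem_closedBall] at hzw ⊢
  have h1 := P.dist_center_le_graph_dist hconn w v
  have h2 : (P.graph.dist w v : ℝ) ≤ D := by
    exact_mod_cast dist_le_of_mem_cornerVertices hconn hσ hD hw hv
  linarith [dist_triangle z (P.center w) (P.center v)]

/-! ### From points of the plane to vertices: the coarse Lipschitz bound. -/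

/-- A choice of a vertex near every point of the plane that varies slowly in the contact graph. -/
theorem exists_near_vertex_map [Infinite V] (hconn : P.graph.Connected) {D : ℕ}
    (hD : ∀ σ ∈ P.faces, P.facialDegree σ ≤ D) :
    ∃ a : EuclideanSpace ℝ (Fin 2) → V, (∀ x, dist x (P.center (a x)) ≤ D + 1) ∧
      (∀ x, ∀ᶠ y in 𝓝 x, P.graph.dist (a x) (a y) ≤ D + 1) ∧
      ∀ v, P.graph.dist (a (P.center v)) v ≤ 1 := by
  have hle : ∀ {v w : V}, v = w ∨ P.graph.Adj v w → P.graph.dist v w ≤ 1 := by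
    rintro v w (rfl | h)
    · simp
    · exact (SimpleGraph.dist_eq_one_iff_adj.2 h).le
  -- On the drawing, the vertex is a corner of all faces nearby; off the drawing, it is any corner
  -- vertex of the face containing the point. Near a point of the drawing, the chosen vertices are
  -- then compared through tangent pennies or through a common face.
  have hex : ∀ x, ∃ a, (x ∈ P.drawing → x ∈ closedBall (P.center a) (1 / 2) ∧
      ∀ᶠ y in 𝓝 x, ∀ σ ∈ P.faces, y ∈ σ → a ∈ P.cornerVertices σ) ∧
      ∀ σ ∈ P.faces, x ∈ σ → a ∈ P.cornerVertices σ := by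
    intro x
    by_cases hx : x ∈ P.drawing
    · obtain ⟨a, ha⟩ := P.exists_vertex_near_drawing hconn hx
      exact ⟨a, fun _ => ha, fun σ hσ hxσ => (subset_compl_drawing_of_mem_faces hσ hxσ hx).elim⟩
    · obtain ⟨σ, hσ, hxσ⟩ := exists_face_of_notMem_drawing hx
      obtain ⟨a, ha⟩ := cornerVertices_nonempty hconn hσ
      refine ⟨a, fun h => (hx h).elim, fun τ hτ hxτ => ?_⟩
      have hsub := subset_face_of_isPreconnected hτ (isPreconnected_of_mem_faces hσ)
        (subset_compl_drawing_of_mem_faces hσ) ⟨x, hxσ, hxτ⟩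
      exact ha.mono (inter_subset_inter_left _ hsub)
  choose a ha using hex
  refine ⟨a, fun x => ?_, fun x => ?_, fun v => ?_⟩
  · by_cases hx : x ∈ P.drawing
    · have := mem_closedBall.1 ((ha x).1 hx).1
      have hD0 : (0 : ℝ) ≤ D := Nat.cast_nonneg D
      linarith
    · obtain ⟨σ, hσ, hxσ⟩ := exists_face_of_notMem_drawing hx
      exact dist_center_le_of_mem_face hconn hσ (hD σ hσ) ((ha x).2 σ hσ hxσ) hxσ
  · by_cases hx : x ∈ P.drawing
    · filter_upwards [((ha x).1 hx).2, P.eventually_mem_closedBall_imp x] with y hy hy'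
      by_cases hyd : y ∈ P.drawing
      · have := hle (P.eq_or_adj_of_mem_closedBall ((ha x).1 hx).1 (hy' _ ((ha y).1 hyd).1))
        omega
      · obtain ⟨σ, hσ, hyσ⟩ := exists_face_of_notMem_drawing hyd
        exact (dist_le_of_mem_cornerVertices hconn hσ (hD σ hσ) (hy σ hσ hyσ)
          ((ha y).2 σ hσ hyσ)).trans (Nat.le_succ D)
    · obtain ⟨σ, hσ, hxσ⟩ := exists_face_of_notMem_drawing hx
      filter_upwards [(isOpen_of_mem_faces hσ).mem_nhds hxσ] with y hyσ
      exact (dist_le_of_mem_cornerVertices hconn hσ (hD σ hσ) ((ha x).2 σ hσ hxσ)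
          ((ha y).2 σ hσ hyσ)).trans (Nat.le_succ D)
  · exact hle (P.eq_or_adj_of_mem_closedBall ((ha _).1 (P.center_mem_drawing v)).1
      (mem_closedBall_self (by norm_num)))

/-- If a choice of near vertices varies slowly, then it is coarsely Lipschitz. -/
theorem exists_graph_dist_le_mul (hconn : P.graph.Connected) {R : ℝ} {k : ℕ}
    {a : EuclideanSpace ℝ (Fin 2) → V} (hR : ∀ x, dist x (P.center (a x)) ≤ R)
    (hk : ∀ x, ∀ᶠ y in 𝓝 x, P.graph.dist (a x) (a y) ≤ k) :
    ∃ K : ℕ, ∀ (n : ℕ) (x y : EuclideanSpace ℝ (Fin 2)), dist x y ≤ n →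
      P.graph.dist (a x) (a y) ≤ K * n := by
  obtain ⟨N, hN⟩ := P.exists_encard_center_le (R + 1)
  -- The local bound alone gives no control on the number of steps. But all vertices chosen over the
  -- unit ball lie among at most `N` vertices, so a chain of any length shortens to a path with at
  -- most `N` vertices.
  have hstep : ∀ x y : EuclideanSpace ℝ (Fin 2), dist x y ≤ 1 →
      P.graph.dist (a x) (a y) ≤ k * N := by
    intro x y hxy
    let U : Set V := {v | dist (P.center v) x ≤ R + 1}
    have hU : ∀ z ∈ closedBall x 1, a z ∈ U := by
      intro z hz
      rw [mem_closedBall] at hz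
      change dist (P.center (a z)) x ≤ R + 1
      linarith [hR z, dist_triangle_left (P.center (a z)) x z]
    let H : SimpleGraph U :=
      { Adj := fun u v => u ≠ v ∧ P.graph.dist u v ≤ k
        symm := ⟨fun u v h => ⟨h.1.symm, by rw [SimpleGraph.dist_comm]; exact h.2⟩⟩
        loopless := ⟨fun u h => h.1 rfl⟩ }
    have hreach : ∀ (hx : a x ∈ U) (hy : a y ∈ U), H.Reachable ⟨a x, hx⟩ ⟨a y, hy⟩ := by
      refine (convex_closedBall x 1).isPreconnected.induction₂
        (fun x y => ∀ (hx : a x ∈ U) (hy : a y ∈ U), H.Reachable ⟨a x, hx⟩ ⟨a y, hy⟩) ?_ ?_ ?_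
        (mem_closedBall_self zero_le_one) (by rwa [mem_closedBall, dist_comm])
      · intro z _
        filter_upwards [nhdsWithin_le_nhds (hk z)] with w hw hz' hw'
        by_cases h : (⟨a z, hz'⟩ : U) = ⟨a w, hw'⟩
        · rw [h]
        · exact SimpleGraph.Adj.reachable (G := H) ⟨h, hw⟩
      · intro z w u _ hw _ hzw hwu hz' hu'
        exact (hzw hz' (hU w hw)).trans (hwu (hU w hw) hu')
      · intro z w _ _ hzw hw' hz'
        exact (hzw hz' hw').symm
    exact SimpleGraph.dist_le_of_reachable_on_finite hconn (hN x) H (fun _ _ h => h.2)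
      (hreach (hU x (mem_closedBall_self zero_le_one))
        (hU y (by rwa [mem_closedBall, dist_comm])))
  refine ⟨k * N, fun n => ?_⟩
  induction n with
  | zero =>
    intro x y hxy
    obtain rfl : x = y := dist_le_zero.1 (by simpa using hxy)
    simp
  | succ n ih =>
    intro x y hxy
    -- This point cuts the segment into pieces of length at most `n` and `1`.
    let z := AffineMap.lineMap x y ((n : ℝ) / (n + 1))
    have hn : (0 : ℝ) < n + 1 := by positivity
    push_cast at hxy
    have h1 : dist x z ≤ n := by
      rw [dist_left_lineMap, Real.norm_eq_abs, abs_of_nonneg (by positivity), div_mul_eq_mul_div,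
        div_le_iff₀ hn]
      exact mul_le_mul_of_nonneg_left hxy (by positivity)
    have h2 : dist z y ≤ 1 := by
      have h3 : 1 - (n : ℝ) / (n + 1) = 1 / (n + 1) := by field_simp; ring
      rw [dist_lineMap_right, h3, Real.norm_eq_abs, abs_of_nonneg (by positivity),
        div_mul_eq_mul_div, one_mul, div_le_iff₀ hn]
      linarith
    have h3 := ih x z h1
    have h4 := hstep z y h2
    have h5 := hconn.dist_triangle (u := a x) (v := a z) (w := a y)
    rw [mul_add, mul_one]
    omega

end PennyConfiguration

/-! ### The integer lattice -/

theorem latticeGraph_adj_iff {w z : ℤ × ℤ} :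
    latticeGraph.Adj w z ↔ (w.1 - z.1) ^ 2 + (w.2 - z.2) ^ 2 = 1 := Iff.rfl

/-- Induction on the taxicab distance: one unit step towards `z`, in the first coordinate while it
differs, lowers the distance by one. -/
theorem exists_latticeGraph_walk (n : ℕ) : ∀ w z : ℤ × ℤ,
    (w.1 - z.1).natAbs + (w.2 - z.2).natAbs = n → ∃ p : latticeGraph.Walk w z, p.length = n := by
  induction n with
  | zero =>
    rintro ⟨w1, w2⟩ ⟨z1, z2⟩ h
    obtain rfl : w1 = z1 := by simp only at h; omega
    obtain rfl : w2 = z2 := by simp only at h; omega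
    exact ⟨.nil, rfl⟩
  | succ n ih =>
    rintro ⟨w1, w2⟩ ⟨z1, z2⟩ h
    simp only at h
    have hcons : ∀ u : ℤ × ℤ, latticeGraph.Adj (w1, w2) u →
        (u.1 - z1).natAbs + (u.2 - z2).natAbs = n →
        ∃ p : latticeGraph.Walk (w1, w2) (z1, z2), p.length = n + 1 := by
      intro u hu hn
      obtain ⟨p, hp⟩ := ih u (z1, z2) hn
      exact ⟨.cons hu p, by simp [hp]⟩
    rcases lt_trichotomy w1 z1 with h1 | h1 | h1
    · exact hcons (w1 + 1, w2) (by simp [latticeGraph_adj_iff]) (by simp only; omega)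
    · rcases lt_trichotomy w2 z2 with h2 | h2 | h2
      · exact hcons (w1, w2 + 1) (by simp [latticeGraph_adj_iff]) (by simp only; omega)
      · omega
      · exact hcons (w1, w2 - 1) (by simp [latticeGraph_adj_iff]) (by simp only; omega)
    · exact hcons (w1 - 1, w2) (by simp [latticeGraph_adj_iff]) (by simp only; omega)

theorem latticeGraph_connected : latticeGraph.Connected where
  preconnected w z := ⟨(exists_latticeGraph_walk _ w z rfl).choose⟩
  nonempty := ⟨0⟩

theorem latticeGraph_dist_le (w z : ℤ × ℤ) :
    (latticeGraph.dist w z : ℝ) ≤ |(w.1 : ℝ) - z.1| + |(w.2 : ℝ) - z.2| := by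
  obtain ⟨p, hp⟩ := exists_latticeGraph_walk _ w z rfl
  have h : ((latticeGraph.dist w z : ℕ) : ℤ) ≤ |w.1 - z.1| + |w.2 - z.2| := by
    have := SimpleGraph.dist_le p
    rw [hp] at this
    rw [Int.abs_eq_natAbs, Int.abs_eq_natAbs]
    exact_mod_cast this
  exact_mod_cast h

/-- The lattice point at the lower left of a point of the plane. -/
noncomputable def floorPoint (x : EuclideanSpace ℝ (Fin 2)) : ℤ × ℤ := (⌊x 0⌋, ⌊x 1⌋)

theorem EuclideanSpace.dist_le_abs_add_abs (x y : EuclideanSpace ℝ (Fin 2)) :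
    dist x y ≤ |x 0 - y 0| + |x 1 - y 1| := by
  rw [EuclideanSpace.dist_eq, Fin.sum_univ_two, Real.dist_eq, Real.dist_eq]
  refine Real.sqrt_le_iff.2 ⟨by positivity, ?_⟩
  nlinarith [mul_nonneg (abs_nonneg (x 0 - y 0)) (abs_nonneg (x 1 - y 1))]

theorem EuclideanSpace.abs_coord_sub_le_dist (x y : EuclideanSpace ℝ (Fin 2)) (i : Fin 2) :
    |x i - y i| ≤ dist x y := by
  rw [dist_eq_norm]
  exact PiLp.norm_apply_le (x - y) i

theorem abs_floor_sub_floor_le (s t : ℝ) : |(⌊s⌋ : ℝ) - ⌊t⌋| ≤ |s - t| + 1 := by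
  have h1 := Int.floor_le s
  have h2 := Int.lt_floor_add_one s
  have h3 := Int.floor_le t
  have h4 := Int.lt_floor_add_one t
  have h5 := neg_abs_le (s - t)
  have h6 := le_abs_self (s - t)
  rw [abs_le]
  constructor <;> linarith

theorem latticeGraph_dist_floorPoint_le (x y : EuclideanSpace ℝ (Fin 2)) :
    (latticeGraph.dist (floorPoint x) (floorPoint y) : ℝ) ≤ 2 * dist x y + 2 := by
  have h := latticeGraph_dist_le (floorPoint x) (floorPoint y)
  simp only [floorPoint] at h ⊢
  linarith [abs_floor_sub_floor_le (x 0) (y 0), abs_floor_sub_floor_le (x 1) (y 1),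
    EuclideanSpace.abs_coord_sub_le_dist x y 0, EuclideanSpace.abs_coord_sub_le_dist x y 1]

theorem abs_sub_le_latticeGraph_dist (w z : ℤ × ℤ) :
    |(w.1 : ℝ) - z.1| ≤ latticeGraph.dist w z ∧ |(w.2 : ℝ) - z.2| ≤ latticeGraph.dist w z := by
  constructor
  · refine dist_map_le_graph_dist latticeGraph_connected (f := fun w : ℤ × ℤ => (w.1 : ℝ)) ?_ w z
    intro a b hab
    rw [latticeGraph_adj_iff] at hab
    rw [Real.dist_eq, ← sq_le_one_iff_abs_le_one]
    exact_mod_cast (by nlinarith [sq_nonneg (a.2 - b.2)] : (a.1 - b.1) ^ 2 ≤ 1)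
  · refine dist_map_le_graph_dist latticeGraph_connected (f := fun w : ℤ × ℤ => (w.2 : ℝ)) ?_ w z
    intro a b hab
    rw [latticeGraph_adj_iff] at hab
    rw [Real.dist_eq, ← sq_le_one_iff_abs_le_one]
    exact_mod_cast (by nlinarith [sq_nonneg (a.1 - b.1)] : (a.2 - b.2) ^ 2 ≤ 1)

theorem dist_le_latticeGraph_dist_floorPoint (x y : EuclideanSpace ℝ (Fin 2)) :
    dist x y ≤ 2 * latticeGraph.dist (floorPoint x) (floorPoint y) + 2 := by
  have hfloor : ∀ s t : ℝ, |s - t| ≤ |(⌊s⌋ : ℝ) - ⌊t⌋| + 1 := by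
    intro s t
    have h1 := Int.floor_le s
    have h2 := Int.lt_floor_add_one s
    have h3 := Int.floor_le t
    have h4 := Int.lt_floor_add_one t
    have h5 := neg_abs_le ((⌊s⌋ : ℝ) - ⌊t⌋)
    have h6 := le_abs_self ((⌊s⌋ : ℝ) - ⌊t⌋)
    rw [abs_le]
    constructor <;> linarith
  have h := abs_sub_le_latticeGraph_dist (floorPoint x) (floorPoint y)
  simp only [floorPoint] at h ⊢
  linarith [hfloor (x 0) (y 0), hfloor (x 1) (y 1), EuclideanSpace.dist_le_abs_add_abs x y, h.1,
    h.2]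

/-! ### The quasi-isometry. -/

theorem theorem1p1 {V : Type*} [Infinite V] (P : PennyConfiguration V)
    (hconn : P.graph.Connected)
    (hdeg : (⨆ σ ∈ P.faces, P.facialDegree σ) < ⊤) :
    QuasiIsometric (graphDist P.graph) (graphDist latticeGraph) := by
  obtain ⟨D, hD⟩ := ENat.ne_top_iff_exists.1 hdeg.ne
  have hD' : ∀ σ ∈ P.faces, P.facialDegree σ ≤ D := fun σ hσ => by
    rw [hD]
    exact le_iSup₂ (f := fun σ (_ : σ ∈ P.faces) => P.facialDegree σ) σ hσ
  obtain ⟨a, haR, hak, hav⟩ := P.exists_near_vertex_map hconn hD'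
  obtain ⟨K, hK⟩ := P.exists_graph_dist_le_mul hconn haR (k := D + 1) (by exact_mod_cast hak)
  -- Rounding the Euclidean distance up costs at most `K`, and replacing `v` and `w` by the vertices
  -- chosen at their centers costs `1` each; `K * (d + 1) + 2` is at most `(K + 1) * (d + 3)`.
  have hupper : ∀ v w, (P.graph.dist v w : ℝ) ≤
      (K + 1) * (dist (P.center v) (P.center w) + 3) := by
    intro v w
    have h1 := hK ⌈dist (P.center v) (P.center w)⌉₊ _ _ (Nat.le_ceil _)
    have h2 := hav v
    have h3 := hav w
    have h4 := hconn.dist_triangle (u := v) (v := a (P.center v)) (w := w)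
    have h5 := hconn.dist_triangle (u := a (P.center v)) (v := a (P.center w)) (w := w)
    rw [SimpleGraph.dist_comm (u := v) (v := a (P.center v))] at h4
    have h6 : (P.graph.dist v w : ℝ) ≤ K * ⌈dist (P.center v) (P.center w)⌉₊ + 2 := by
      exact_mod_cast (by omega : P.graph.dist v w ≤ K * ⌈dist (P.center v) (P.center w)⌉₊ + 2)
    have h7 := Nat.ceil_lt_add_one (dist_nonneg (x := P.center v) (y := P.center w))
    have hK0 : (0 : ℝ) ≤ K := Nat.cast_nonneg K
    nlinarith [mul_le_mul_of_nonneg_left h7.le hK0,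
      dist_nonneg (x := P.center v) (y := P.center w)]
  have hD0 : (0 : ℝ) ≤ D := Nat.cast_nonneg D
  have hK0 : (0 : ℝ) ≤ K := Nat.cast_nonneg K
  -- With `L` the lattice distance, the Euclidean distance is at most `2 * L + 2`, so `hupper` gives
  -- `(K + 1) * (2 * L + 5)`, hence the factor `2 * (K + 1)`. Density needs `C` above `2 * (D + 1) +
  -- 2 = 2 * D + 4`.
  refine ⟨fun v => floorPoint (P.center v), 2 * (K + 1), 2 * D + 5, by linarith, by linarith,
    fun v w => ⟨?_, ?_⟩, fun y => ?_⟩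
  · have h1 := hupper v w
    have h2 := dist_le_latticeGraph_dist_floorPoint (P.center v) (P.center w)
    have hpos : (0 : ℝ) < 2 * (K + 1) := by linarith
    simp only [graphDist]
    rw [sub_le_iff_le_add, inv_mul_le_iff₀ hpos]
    nlinarith [mul_nonneg hK0 hD0]
  · have h1 := latticeGraph_dist_floorPoint_le (P.center v) (P.center w)
    have h2 := P.dist_center_le_graph_dist hconn v w
    have h3 : (0 : ℝ) ≤ P.graph.dist v w := Nat.cast_nonneg _
    simp only [graphDist]
    nlinarith [mul_nonneg hK0 h3]
  · let x : EuclideanSpace ℝ (Fin 2) := !₂[(y.1 : ℝ), (y.2 : ℝ)]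
    have hx : floorPoint x = y := by simp [floorPoint, x]
    refine ⟨a x, ?_⟩
    have h1 := latticeGraph_dist_floorPoint_le x (P.center (a x))
    rw [hx] at h1
    simp only [graphDist]
    linarith [haR x]
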